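/- Let $G$ be a finite nontrivial group, let $n\ge 2$, and write $\underline n=\{1,\dots,n\}$. Consider triples $(I,\pi,[f]_\pi)$ where $I\subseteq\underline n$, $\pi$ is a partition of $I$, and $[f]_\pi$ is the class of a function $f:I\to G$ under the relation $f\sim_\pi h$ meaning that on each block $B$ of $\pi$ there is $c\in G$ with $f(i)=c\,h(i)$ for all $i\in B$. Let $V$ be the set of those triples for which either (V1) $|I|=n-1$ and every block of $\pi$ is a singleton, or (V2) $I=\underline n$ and $\pi$ has exactly $n-1$ blocks. (These are the atoms of the Dowling lattice $Q_n(G)$.) Fix $y\in G\setminus\{1\}$. To a triple of type (V1) with $I=\underline n\setminus\{i\}$ associate a loop at $i$ labelled $y$; to a triple of type (V2) with non-singleton block $\{i,j\}$ associate the pair of mutually inverse directed edges $i\to j$ labelled $g=f(i)^{-1}f(j)$ and $j\to i$ labelled $g^{-1}$. For $Z\subseteq V$ let $\Gamma(Z)$ be the directed labelled graph formed by the edges associated with the elements of $Z$, and let $\Gamma_0(Z)$ be the undirected multigraph with one edge for each element of $Z$ (a loop, or the edge underlying a pair of inverse edges). A cycle $q_0\to q_1\to\dots\to q_m=q_0$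 of $\Gamma(Z)$ with labels $g_1,\dots,g_m$ is $G$-nontrivial if $g_1\cdots g_m\ne 1$. The Dowling matroid $\mathcal H=(V,H)$ defined by $G$ and $n$ has as set $H$ of independent sets all $Z\subseteq V$ such that each connected component of $\Gamma_0(Z)$ is either a tree or has as many edges as vertices, and in the latter case the component contains a $G$-nontrivial cycle of $\Gamma(Z)$. For $m\ge 0$ let $H_m=\{X\in H : |X|\le m\}$, and for $k\ge1$ let $$T(H_k)=\{T\subseteq V : \forall X\in H_{k-1}\text{ with }X\subseteq T,\ \forall p\in V\setminus T,\ X\cup\{p\}\in H_k\}.$$ For a nonempty family $R$ of subsets of $V$ let $J(R)$ be the set of all $X=\{x_1,\dots,x_m\}\subseteq V$ such that there is a chain $T_0\subset T_1\subset\dots\subset T_m$ in $R$ with $x_i\in T_i\setminus T_{i-1}$ for $i=1,\dots,m$. Then, for every $k\ge 3$, $$H=J(T(H_k)).$$ If $n\ge 3$, then the same equality holds for every $k\ge 3$ also when $T(H_k)$ is defined from the complex $K=H_k$ alone, as $T(K)=\{T\subseteq V : \forall X\in K\text{ with }X\subseteq T,\ |X|\le d,\ \forall p\in V\setminus T,\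 X\cup\{p\}\in K\}$, where $d=\max_{X\in K}|X|-1$ is the dimension of $K$. -/

import Mathlib

/-! ### Operators on families of subsets

A simplicial complex on a finite set `V` is given by its set `H` of faces. -/

/-- The truncation `H_k`: the faces with at most `k` elements. -/
def truncation {V : Type*} (H : Set (Set V)) (k : ℕ) : Set (Set V) :=
  {X | X ∈ H ∧ X.ncard ≤ k}

/-- The dimension of a complex on a finite set: one less than the maximal size of a face. -/
noncomputable def complexDim {V : Type*} (H : Set (Set V)) : ℕ :=
  sSup {m | ∃ X ∈ H, X.ncard = m} - 1

/-- The family `T(K)`, for a complex `K` of dimension `d`: all `T` such that for every `X ∈ K_d`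
with `X ⊆ T` and every `p ∉ T` one has `X ∪ {p} ∈ K`. -/
def familyT {V : Type*} (K : Set (Set V)) : Set (Set V) :=
  {T | ∀ X ∈ truncation K (complexDim K), X ⊆ T → ∀ p, p ∉ T → insert p X ∈ K}

/-- The family `T(H_k)`, written out for a truncation: all `T` such that for every `X ∈ H_{k-1}`
with `X ⊆ T` and every `p ∉ T` one has `X ∪ {p} ∈ H_k`. -/
def truncT {V : Type*} (H : Set (Set V)) (k : ℕ) : Set (Set V) :=
  {T | ∀ X ∈ truncation H (k - 1), X ⊆ T → ∀ p, p ∉ T → insert p X ∈ truncation H k}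

/-- `J(R)`: the sets `X = {x₁, …, xₘ}` for which there is a chain `T₀ ⊂ T₁ ⊂ ⋯ ⊂ Tₘ` in `R` with
`xᵢ ∈ Tᵢ \ Tᵢ₋₁` for all `i`, i.e. the transversals of the successive differences for chains
of `R`. -/
def transversals {V : Type*} (R : Set (Set V)) : Set (Set V) :=
  {X | ∃ (m : ℕ) (T : Fin (m + 1) → Set V) (x : Fin m → V),
    StrictMono T ∧ (∀ i, T i ∈ R) ∧ (∀ i : Fin m, x i ∈ T i.succ \ T i.castSucc) ∧
    X = Set.range x}

/-! ### The Dowling matroid -/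

/-- The relation `f ∼_π h` on functions `I → G`: on every block of `π`, the function `f` is a left
translate of `h`. -/
def blockSetoid {n : ℕ} (G : Type*) [Group G] {I : Finset (Fin n)} (π : Finpartition I) :
    Setoid (I → G) where
  r f h := ∀ B ∈ π.parts, ∃ c : G, ∀ i : I, (i : Fin n) ∈ B → f i = c * h i
  iseqv :=
    { refl := fun _ _ _ => ⟨1, fun _ _ => (one_mul _).symm⟩
      symm := fun hfh B hB => by
        obtain ⟨c, hc⟩ := hfh B hB
        exact ⟨c⁻¹, fun i hi => by rw [hc i hi, inv_mul_cancel_left]⟩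
      trans := fun hfh hhk B hB => by
        obtain ⟨c, hc⟩ := hfh B hB
        obtain ⟨d, hd⟩ := hhk B hB
        exact ⟨c * d, fun i hi => by rw [hc i hi, hd i hi, mul_assoc]⟩ }

/-- The triples `(I, π, [f]_π)` with `I ⊆ {1, …, n}`, `π` a partition of `I` and `f : I → G`. -/
structure SPC (n : ℕ) (G : Type*) [Group G] where
  support : Finset (Fin n)
  partition : Finpartition support
  cls : Quotient (blockSetoid G partition)

/-- The two types of atoms of the Dowling lattice: `|I| = n - 1` and all blocks of `π` are
singletons, or `I = {1, …, n}` and `π` has precisely `n - 1` blocks. -/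
def SPC.IsAtomType {n : ℕ} {G : Type*} [Group G] (s : SPC n G) : Prop :=
  (s.support.card + 1 = n ∧ ∀ B ∈ s.partition.parts, B.card = 1) ∨
  (s.support = Finset.univ ∧ s.partition.parts.card + 1 = n)

/-- The ground set of the Dowling matroid. -/
abbrev DowlingPoint (n : ℕ) (G : Type*) [Group G] : Type _ := {s : SPC n G // s.IsAtomType}

instance DowlingPoint.instFinite (n : ℕ) (G : Type*) [Group G] [Finite G] :
    Finite (DowlingPoint n G) := by
  have hinj : Function.Injective
      (fun s : SPC n G => (⟨s.support, s.partition, s.cls⟩ :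
        Σ (I : Finset (Fin n)) (π : Finpartition I), Quotient (blockSetoid G π))) := by
    rintro ⟨I, π, c⟩ ⟨I', π', c'⟩ h
    simp only [Sigma.mk.injEq] at h
    obtain ⟨rfl, h⟩ := h
    have h := eq_of_heq h
    simp only [Sigma.mk.injEq] at h
    obtain ⟨rfl, h⟩ := h
    obtain rfl := eq_of_heq h
    rfl
  have : Finite (SPC n G) := Finite.of_injective _ hinj
  exact Subtype.finite

/-- The labelled directed edges `i ⟶ j` with label `g` of the graph `Γ(a)`. If the support of `a`
is `{1, …, n} \ {i}`, there is exactly one edge, a loop at `i` with label `y`. If the support is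
`{1, …, n}` and `{i, j}` is the nonsingular block, the edges are the one from `i` to `j` with label
`f(i)⁻¹ f(j)` and its inverse. -/
def DowlingPoint.Edge {n : ℕ} {G : Type*} [Group G] (y : G) (a : DowlingPoint n G)
    (i : Fin n) (g : G) (j : Fin n) : Prop :=
  (i = j ∧ i ∉ a.1.support ∧ g = y) ∨
  (i ≠ j ∧ (∃ B ∈ a.1.partition.parts, i ∈ B ∧ j ∈ B) ∧
    ∃ f : a.1.support → G, Quotient.mk (blockSetoid G a.1.partition) f = a.1.cls ∧
      ∃ (hi : i ∈ a.1.support) (hj : j ∈ a.1.support), g = (f ⟨i, hi⟩)⁻¹ * f ⟨j, hj⟩)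

/-- `DowlingPath y Z i g j`: in `Γ(Z)`, the union of the graphs `Γ(a)` with `a ∈ Z`, there is a
directed path (possibly with repetitions) from `i` to `j` whose labels have product `g`. -/
inductive DowlingPath {n : ℕ} {G : Type*} [Group G] (y : G) (Z : Set (DowlingPoint n G)) :
    Fin n → G → Fin n → Prop
  | nil (i : Fin n) : DowlingPath y Z i 1 i
  | cons {i j l : Fin n} {g h : G} {a : DowlingPoint n G} (ha : a ∈ Z) (he : a.Edge y i g j)
      (hp : DowlingPath y Z j h l) : DowlingPath y Z i (g * h) l

/-- The vertex set of the connected component of `i` in the multigraph `Γ₀(Z)`. Here all of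
`{1, …, n}` serves as vertex set; a vertex on no edge is a component which is a tree. -/
def dowlingComponent {n : ℕ} {G : Type*} [Group G] (y : G) (Z : Set (DowlingPoint n G))
    (i : Fin n) : Set (Fin n) :=
  {j | ∃ g, DowlingPath y Z i g j}

/-- The edges of `Γ₀(Z)` in the connected component of `i`. The multigraph `Γ₀(Z)` has exactly one
edge for each element of `Z` (a loop, or a pair of inverse edges of `Γ(Z)`). -/
def dowlingComponentEdges {n : ℕ} {G : Type*} [Group G] (y : G) (Z : Set (DowlingPoint n G))
    (i : Fin n) : Set (DowlingPoint n G) :=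
  {a | a ∈ Z ∧ ∃ j ∈ dowlingComponent y Z i, ∃ g l, a.Edge y j g l}

/-- The independent sets of the Dowling matroid: each connected component of `Γ₀(Z)` is a tree (one
vertex more than edges) or is unicyclic (as many vertices as edges) and contains a cycle of `Γ(Z)`
whose labels have a product different from `1`. -/
def dowlingIndep {n : ℕ} {G : Type*} [Group G] (y : G) : Set (Set (DowlingPoint n G)) :=
  {Z | ∀ i : Fin n,
    (dowlingComponent y Z i).ncard = (dowlingComponentEdges y Z i).ncard + 1 ∨
    ((dowlingComponent y Z i).ncard = (dowlingComponentEdges y Z i).ncard ∧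
      ∃ j ∈ dowlingComponent y Z i, ∃ g, g ≠ 1 ∧ DowlingPath y Z j g j)}

/-! Independence is governed by a closure operator: an edge from `i` to `j` labelled `g` is in the
closure of `X` if `X` has a path from `i` to `j` with product `g`, or if both ends lie in components
with a nontrivial closed path. A component never has more vertices than its weight
(`ncard_dowlingComponent_le`), and independence means equality everywhere. Tracking both numbers
under insertion gives `insert_mem_dowlingIndep_iff`: a new point extends an independent set iff it
avoids the closure.

Hence the closures of the initial segments of an independent set form a chain of the kind used in
`transversals`, and conversely transversals of chains of flats are independent. So any family of
flats containing all closures will do (`dowlingIndep_eq_transversals`). Closures belong to `truncT`.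
That members of `truncT` are flats is the crux: for `k ≥ 3` the condition tests all independent sets
of at most two points, so it makes `T` line-closed, and line-closed sets are flats because a path
can be contracted two edges at a time (`IsLineClosed.path`). For `familyT` the same tests are
available once the dimension is at least 2, which needs three independent points, hence `3 ≤ n`. -/

/-! ### The edges carried by a single point -/

namespace DowlingPoint

variable {n : ℕ} {G : Type*} [Group G] {y : G}

theorem Edge.symm {a : DowlingPoint n G} {i j : Fin n} {g : G} (h : a.Edge y i g j) (hij : i ≠ j) :
    a.Edge y j g⁻¹ i := by
  rcases h with ⟨h, -⟩ | ⟨-, ⟨B, hB, hiB, hjB⟩, f, hf, hi, hj, rfl⟩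
  · exact absurd h hij
  · exact Or.inr ⟨hij.symm, ⟨B, hB, hjB, hiB⟩, f, hf, hj, hi, by simp⟩

theorem Edge.eq_of_loop {a : DowlingPoint n G} {i : Fin n} {g : G} (h : a.Edge y i g i) : g = y := by
  rcases h with ⟨-, -, h⟩ | ⟨h, -⟩
  · exact h
  · exact absurd rfl h

/-- The excess of the cardinality of a finite set over the number of blocks of a partition. -/
theorem _root_.Finpartition.sum_card_sub_one {α : Type*} [DecidableEq α] {s : Finset α}
    (P : Finpartition s) : ∑ B ∈ P.parts, (B.card - 1) + P.parts.card = s.card := by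
  rw [Finset.card_eq_sum_ones, ← Finset.sum_add_distrib, ← P.sum_card_parts]
  refine Finset.sum_congr rfl fun B hB => ?_
  have := (P.nonempty_of_mem_parts hB).card_pos
  omega

theorem exists_edge (y : G) (a : DowlingPoint n G) : ∃ i g j, a.Edge y i g j := by
  obtain ⟨⟨I, π, c⟩, h⟩ := a
  rcases h with ⟨h, -⟩ | ⟨h, h'⟩
  · have : ∃ i, i ∉ I := by
      by_contra! hall
      have : I = Finset.univ := Finset.eq_univ_iff_forall.2 hall
      simp [this] at h
    obtain ⟨i, hi⟩ := this
    exact ⟨i, y, i, Or.inl ⟨rfl, hi, rfl⟩⟩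
  -- The total excess over singletons is `n - (n - 1) = 1`, so some block has two elements.
  · simp only at h h'
    subst h
    have hs := π.sum_card_sub_one
    rw [Finset.card_univ, Fintype.card_fin] at hs
    have : ∃ B ∈ π.parts, B.card - 1 ≠ 0 := by
      by_contra! hall
      rw [Finset.sum_eq_zero hall] at hs
      omega
    obtain ⟨B, hB, hc⟩ := this
    obtain ⟨i, hi, j, hj, hij⟩ := Finset.one_lt_card.1 (show 1 < B.card by omega)
    obtain ⟨f, hf⟩ := Quotient.exists_rep c
    exact ⟨i, _, j, Or.inr ⟨hij, ⟨B, hB, hi, hj⟩, f, hf, Finset.mem_univ _, Finset.mem_univ _, rfl⟩⟩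

/-- The directed edges of a point of the Dowling matroid are unique up to reversal. -/
theorem Edge.unique {a : DowlingPoint n G} {i j i' j' : Fin n} {g g' : G} (h : a.Edge y i g j)
    (h' : a.Edge y i' g' j') :
    (i' = i ∧ g' = g ∧ j' = j) ∨ (i ≠ j ∧ i' = j ∧ g' = g⁻¹ ∧ j' = i) := by
  obtain ⟨⟨I, π, c⟩, ha⟩ := a
  simp only [Edge] at h h'
  rcases ha with ⟨hI, hB⟩ | ⟨hI, hB⟩
  · simp only at hI hB
    have key : ∀ i j, i ≠ j → ¬ ∃ B ∈ π.parts, i ∈ B ∧ j ∈ B := by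
      rintro i j hij ⟨B, hBm, hi, hj⟩
      exact hij (Finset.card_le_one.1 (hB B hBm).le i hi j hj)
    rcases h with ⟨rfl, hi, rfl⟩ | ⟨hij, h, -⟩
    · rcases h' with ⟨rfl, hi', rfl⟩ | ⟨hij', h', -⟩
      · have hc : (Iᶜ).card ≤ 1 := by
          rw [Finset.card_compl, Fintype.card_fin]
          omega
        have := Finset.card_le_one.1 hc i' (by simpa using hi') i (by simpa using hi)
        exact Or.inl ⟨this, rfl, this⟩
      · exact absurd h' (key _ _ hij')
    · exact absurd h (key _ _ hij)
  · simp only at hI hB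
    subst hI
    rcases h with ⟨-, hi, -⟩ | ⟨hij, ⟨B, hBm, hiB, hjB⟩, f, hf, hi, hj, rfl⟩
    · exact absurd (Finset.mem_univ _) hi
    rcases h' with ⟨-, hi', -⟩ | ⟨hij', ⟨B', hBm', hiB', hjB'⟩, f', hf', hi', hj', rfl⟩
    · exact absurd (Finset.mem_univ _) hi'
    have hs := π.sum_card_sub_one
    rw [Finset.card_univ, Fintype.card_fin] at hs
    have hc : 1 < B.card := Finset.one_lt_card.2 ⟨i, hiB, j, hjB, hij⟩
    have hc' : 1 < B'.card := Finset.one_lt_card.2 ⟨i', hiB', j', hjB', hij'⟩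
    -- Two distinct nonsingleton blocks would contribute at least 2 to an excess of 1.
    have hBB : B' = B := by
      by_contra hne
      have := Finset.sum_le_sum_of_subset (f := fun B => B.card - 1)
        (show {B, B'} ⊆ π.parts by
          intro b hb
          rcases Finset.mem_insert.1 hb with rfl | hb
          · exact hBm
          · rwa [Finset.mem_singleton.1 hb])
      rw [Finset.sum_pair (Ne.symm hne)] at this
      omega
    subst hBB
    have hcard : B'.card = 2 := by
      have := Finset.single_le_sum (f := fun B => B.card - 1) (fun _ _ => Nat.zero_le _) hBm
      omega
    have hBeq : B' = {i, j} := by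
      symm
      apply Finset.eq_of_subset_of_card_le
      · intro b hb
        rcases Finset.mem_insert.1 hb with rfl | hb
        · exact hiB
        · rwa [Finset.mem_singleton.1 hb]
      · rw [hcard, Finset.card_pair hij]
    -- Representatives differ on the block by a left factor `d`, which cancels in `f(i)⁻¹ f(j)`.
    obtain ⟨d, hd⟩ := Quotient.exact (hf'.trans hf.symm) B' hBm
    rw [hd ⟨i', hi'⟩ hiB', hd ⟨j', hj'⟩ hjB']
    rw [hBeq] at hiB' hjB'
    simp only [Finset.mem_insert, Finset.mem_singleton] at hiB' hjB'
    rcases hiB' with rfl | rfl <;> rcases hjB' with rfl | rfl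
    · exact absurd rfl hij'
    · left; refine ⟨rfl, by group, rfl⟩
    · right; refine ⟨hij, rfl, by group, rfl⟩
    · exact absurd rfl hij'

theorem exists_loop (y : G) (i : Fin n) : ∃ a : DowlingPoint n G, a.Edge y i y i := by
  refine ⟨⟨⟨Finset.univ.erase i, ⊥, Quotient.mk _ fun _ => 1⟩, Or.inl ⟨?_, ?_⟩⟩, Or.inl ⟨rfl, ?_, rfl⟩⟩
  · have := i.pos
    simp only [Finset.card_erase_of_mem (Finset.mem_univ _), Finset.card_univ, Fintype.card_fin]
    omega
  · intro B hB
    obtain ⟨b, -, rfl⟩ := Finpartition.mem_bot_iff.1 hB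
    simp
  · simp

theorem exists_edge_of_ne (y : G) {i j : Fin n} (hij : i ≠ j) (g : G) :
    ∃ a : DowlingPoint n G, a.Edge y i g j := by
  have hd : Disjoint ({i, j}ᶜ : Finset (Fin n)) {i, j} := disjoint_compl_left
  have hne : ({i, j} : Finset (Fin n)) ≠ ⊥ := Finset.insert_ne_empty _ _
  let π : Finpartition (Finset.univ : Finset (Fin n)) :=
    (⊥ : Finpartition ({i, j}ᶜ : Finset (Fin n))).extend hne hd compl_sup_eq_top
  have hcard : π.parts.card + 1 = n := by
    have h2 : ({i, j} : Finset (Fin n)).card = 2 := Finset.card_pair hij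
    have hle := Finset.card_le_univ ({i, j} : Finset (Fin n))
    rw [Fintype.card_fin] at hle
    have := Finpartition.card_extend (⊥ : Finpartition ({i, j}ᶜ : Finset (Fin n))) {i, j} Finset.univ
      (hb := hne) (hab := hd) (hc := compl_sup_eq_top)
    change π.parts.card = _ at this
    rw [this, Finpartition.card_bot, Finset.card_compl, Fintype.card_fin]
    omega
  refine ⟨⟨⟨Finset.univ, π, Quotient.mk _ fun v => if (v : Fin n) = j then g else 1⟩,
    Or.inr ⟨rfl, hcard⟩⟩, Or.inr ⟨hij, ⟨{i, j}, ?_, by simp, by simp⟩, _, rfl,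
    Finset.mem_univ _, Finset.mem_univ _, by simp [hij]⟩⟩
  exact Finset.mem_insert_self _ _

end DowlingPoint

/-! ### Paths and their labels -/

namespace DowlingPath

variable {n : ℕ} {G : Type*} [Group G] {y : G} {X Y : Set (DowlingPoint n G)}
  {i j l : Fin n} {g h : G}

theorem trans (hp : DowlingPath y X i g j) (hq : DowlingPath y X j h l) :
    DowlingPath y X i (g * h) l := by
  induction hp with
  | nil i => simpa using hq
  | cons ha he _ ih => rw [mul_assoc]; exact cons ha he (ih hq)

theorem mono (hXY : X ⊆ Y) (hp : DowlingPath y X i g j) : DowlingPath y Y i g j := by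
  induction hp with
  | nil i => exact nil i
  | cons ha he _ ih => exact cons (hXY ha) he ih

theorem of_edge {a : DowlingPoint n G} (ha : a ∈ X) (he : a.Edge y i g j) :
    DowlingPath y X i g j := by
  simpa using cons ha he (nil j)

theorem pow (hp : DowlingPath y X i g i) (m : ℕ) : DowlingPath y X i (g ^ m) i := by
  induction m with
  | zero => simpa using nil i
  | succ m ih => rw [pow_succ]; exact ih.trans hp

/-- A loop has no reverse edge, but as `G` is finite, going round it often enough produces the
inverse label. -/
theorem edge_symm [Finite G] {a : DowlingPoint n G} (ha : a ∈ X) (he : a.Edge y i g j) :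
    DowlingPath y X j g⁻¹ i := by
  by_cases hij : i = j
  · subst hij
    obtain ⟨m, hm⟩ := (isOfFinOrder_of_finite g).mem_powers_iff_mem_zpowers.2
      (inv_mem (Subgroup.mem_zpowers g))
    simp only at hm
    rw [← hm]
    exact (of_edge ha he).pow m
  · exact of_edge ha (he.symm hij)

theorem symm [Finite G] (hp : DowlingPath y X i g j) : DowlingPath y X j g⁻¹ i := by
  induction hp with
  | nil i => simpa using nil i
  | cons ha he _ ih => rw [mul_inv_rev]; exact ih.trans (edge_symm ha he)

/-- A vertex on no edge is joined to itself only. -/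
theorem eq_of_isolated (hi : ∀ a ∈ X, ∀ g j, ¬ a.Edge y i g j) (hp : DowlingPath y X i g j) :
    j = i ∧ g = 1 := by
  cases hp with
  | nil => exact ⟨rfl, rfl⟩
  | cons ha he _ => exact absurd he (hi _ ha _ _)

end DowlingPath

/-! ### The closure operator -/

/-- The component of `i` contains a closed path at `i` with nontrivial label. -/
def DowlingUnbalanced {n : ℕ} {G : Type*} [Group G] (y : G) (X : Set (DowlingPoint n G))
    (i : Fin n) : Prop :=
  ∃ g, g ≠ 1 ∧ DowlingPath y X i g i

/-- The relation that the edge from `i` to `j` with label `g` is spanned by `X`. -/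
def DowlingSpans {n : ℕ} {G : Type*} [Group G] (y : G) (X : Set (DowlingPoint n G))
    (i : Fin n) (g : G) (j : Fin n) : Prop :=
  DowlingPath y X i g j ∨ DowlingUnbalanced y X i ∧ DowlingUnbalanced y X j

/-- The closure operator of the Dowling matroid. -/
def dowlingClosure {n : ℕ} {G : Type*} [Group G] (y : G) (X : Set (DowlingPoint n G)) :
    Set (DowlingPoint n G) :=
  {p | ∃ i g j, p.Edge y i g j ∧ DowlingSpans y X i g j}

section Closure

variable {n : ℕ} {G : Type*} [Group G] {y : G} {X Y : Set (DowlingPoint n G)}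
  {i j l : Fin n} {g h : G}

theorem DowlingUnbalanced.mono (hXY : X ⊆ Y) (hi : DowlingUnbalanced y X i) :
    DowlingUnbalanced y Y i := by
  obtain ⟨g, hg, hp⟩ := hi
  exact ⟨g, hg, hp.mono hXY⟩

theorem DowlingUnbalanced.of_path [Finite G] (hj : DowlingUnbalanced y X j)
    (hp : DowlingPath y X i g j) : DowlingUnbalanced y X i := by
  obtain ⟨h, hh, hq⟩ := hj
  refine ⟨g * h * g⁻¹, ?_, (hp.trans hq).trans hp.symm⟩
  rwa [Ne, conj_eq_one_iff]

theorem DowlingSpans.mono (hXY : X ⊆ Y) (hs : DowlingSpans y X i g j) : DowlingSpans y Y i g j :=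
  hs.imp (fun hp => hp.mono hXY) fun hu => ⟨hu.1.mono hXY, hu.2.mono hXY⟩

theorem DowlingSpans.symm [Finite G] (hs : DowlingSpans y X i g j) : DowlingSpans y X j g⁻¹ i :=
  hs.imp (fun hp => hp.symm) fun hu => ⟨hu.2, hu.1⟩

theorem DowlingSpans.trans [Finite G] (hs : DowlingSpans y X i g j) (ht : DowlingSpans y X j h l) :
    DowlingSpans y X i (g * h) l := by
  rcases hs with hp | ⟨hi, hj⟩
  · rcases ht with hq | ⟨hj, hl⟩
    · exact Or.inl (hp.trans hq)
    · exact Or.inr ⟨hj.of_path hp, hl⟩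
  · rcases ht with hq | ⟨-, hl⟩
    · exact Or.inr ⟨hi, hj.of_path hq.symm⟩
    · exact Or.inr ⟨hi, hl⟩

theorem DowlingSpans.unbalanced (hs : DowlingSpans y X i g i) (hg : g ≠ 1) :
    DowlingUnbalanced y X i :=
  hs.elim (fun hp => ⟨g, hg, hp⟩) fun hu => hu.1

theorem mem_dowlingClosure_iff [Finite G] {p : DowlingPoint n G} (he : p.Edge y i g j) :
    p ∈ dowlingClosure y X ↔ DowlingSpans y X i g j := by
  refine ⟨?_, fun hs => ⟨i, g, j, he, hs⟩⟩
  rintro ⟨i', g', j', he', hs⟩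
  rcases he'.unique he with ⟨rfl, rfl, rfl⟩ | ⟨-, rfl, rfl, rfl⟩
  · exact hs
  · exact hs.symm

theorem dowlingClosure_mono (hXY : X ⊆ Y) : dowlingClosure y X ⊆ dowlingClosure y Y := by
  rintro p ⟨i, g, j, he, hs⟩
  exact ⟨i, g, j, he, hs.mono hXY⟩

theorem subset_dowlingClosure : X ⊆ dowlingClosure y X := by
  intro p hp
  obtain ⟨i, g, j, he⟩ := p.exists_edge y
  exact ⟨i, g, j, he, Or.inl (.of_edge hp he)⟩

/-- Spanned edges compose, so a path in the closure is spanned as a whole; this yields idempotence.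
-/
theorem DowlingPath.spans_of_dowlingClosure [Finite G]
    (hp : DowlingPath y (dowlingClosure y X) i g j) : DowlingSpans y X i g j := by
  induction hp with
  | nil i => exact Or.inl (.nil i)
  | cons ha he _ ih => exact ((mem_dowlingClosure_iff he).1 ha).trans ih

theorem dowlingClosure_dowlingClosure_subset [Finite G] :
    dowlingClosure y (dowlingClosure y X) ⊆ dowlingClosure y X := by
  rintro p ⟨i, g, j, he, hs⟩
  refine ⟨i, g, j, he, ?_⟩
  rcases hs with hp | ⟨⟨a, ha, hp⟩, b, hb, hq⟩
  · exact hp.spans_of_dowlingClosure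
  · exact Or.inr ⟨hp.spans_of_dowlingClosure.unbalanced ha,
      hq.spans_of_dowlingClosure.unbalanced hb⟩

end Closure

/-! ### Components after adding one point -/

section Insert

variable {n : ℕ} {G : Type*} [Group G] {y : G} {X : Set (DowlingPoint n G)}
  {p : DowlingPoint n G} {i j v w : Fin n} {g h : G}

theorem dowlingComponent_eq [Finite G] (hv : v ∈ dowlingComponent y X i) :
    dowlingComponent y X v = dowlingComponent y X i := by
  obtain ⟨a, ha⟩ := hv
  ext w
  exact ⟨fun ⟨b, hb⟩ => ⟨_, ha.trans hb⟩, fun ⟨b, hb⟩ => ⟨_, ha.symm.trans hb⟩⟩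

theorem mem_dowlingComponent_self : i ∈ dowlingComponent y X i := ⟨1, .nil i⟩

theorem dowlingComponentEdges_eq [Finite G] (hv : v ∈ dowlingComponent y X i) :
    dowlingComponentEdges y X v = dowlingComponentEdges y X i := by
  simp only [dowlingComponentEdges, dowlingComponent_eq hv]

theorem dowlingUnbalanced_iff [Finite G] (hv : v ∈ dowlingComponent y X i) :
    DowlingUnbalanced y X v ↔ DowlingUnbalanced y X i := by
  obtain ⟨a, ha⟩ := hv
  exact ⟨fun hu => hu.of_path ha, fun hu => hu.of_path ha.symm⟩

theorem DowlingPath.of_insert [Finite G] (he : p.Edge y i g j)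
    (hp : DowlingPath y (insert p X) v h w) :
    DowlingPath y X v h w ∨ v ∈ dowlingComponent y X i ∪ dowlingComponent y X j := by
  induction hp with
  | nil v => exact Or.inl (.nil v)
  | cons ha he' _ ih =>
    rcases ha with rfl | ha
    · right
      rcases he.unique he' with ⟨rfl, -, -⟩ | ⟨-, rfl, -⟩
      · exact Or.inl mem_dowlingComponent_self
      · exact Or.inr mem_dowlingComponent_self
    · rcases ih with ih | ⟨b, hb⟩ | ⟨b, hb⟩
      · exact Or.inl (.cons ha he' ih)
      · exact Or.inr (Or.inl ⟨_, hb.trans (DowlingPath.edge_symm ha he')⟩)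
      · exact Or.inr (Or.inr ⟨_, hb.trans (DowlingPath.edge_symm ha he')⟩)

theorem dowlingComponent_insert [Finite G] (he : p.Edge y i g j) :
    dowlingComponent y (insert p X) i = dowlingComponent y X i ∪ dowlingComponent y X j := by
  ext w
  constructor
  · rintro ⟨a, ha⟩
    rcases ha.symm.of_insert he with h | h
    · exact Or.inl ⟨_, h.symm⟩
    · exact h
  · rintro (⟨a, ha⟩ | ⟨a, ha⟩)
    · exact ⟨a, ha.mono (Set.subset_insert _ _)⟩
    · exact ⟨_, .cons (Set.mem_insert _ _) he (ha.mono (Set.subset_insert _ _))⟩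

theorem dowlingComponentEdges_insert [Finite G] (he : p.Edge y i g j) :
    dowlingComponentEdges y (insert p X) i =
      insert p (dowlingComponentEdges y X i ∪ dowlingComponentEdges y X j) := by
  ext a
  simp only [dowlingComponentEdges, dowlingComponent_insert he, Set.mem_ofPred_eq,
    Set.mem_insert_iff, Set.mem_union]
  constructor
  · rintro ⟨rfl | ha, v, hv | hv, h⟩
    · exact Or.inl rfl
    · exact Or.inl rfl
    · exact Or.inr (Or.inl ⟨ha, v, hv, h⟩)
    · exact Or.inr (Or.inr ⟨ha, v, hv, h⟩)
  · rintro (rfl | ⟨ha, v, hv, h⟩ | ⟨ha, v, hv, h⟩)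
    · exact ⟨Or.inl rfl, i, Or.inl mem_dowlingComponent_self, g, j, he⟩
    · exact ⟨Or.inr ha, v, Or.inl hv, h⟩
    · exact ⟨Or.inr ha, v, Or.inr hv, h⟩

theorem DowlingPath.insert_iff [Finite G] (he : p.Edge y i g j)
    (hv : v ∉ dowlingComponent y (insert p X) i) :
    DowlingPath y (insert p X) v h w ↔ DowlingPath y X v h w := by
  refine ⟨fun hp => (hp.of_insert he).resolve_right ?_, fun hp => hp.mono (Set.subset_insert _ _)⟩
  rwa [← dowlingComponent_insert he]

theorem dowlingComponent_insert_of_notMem [Finite G] (he : p.Edge y i g j)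
    (hv : v ∉ dowlingComponent y (insert p X) i) :
    dowlingComponent y (insert p X) v = dowlingComponent y X v := by
  simp only [dowlingComponent, DowlingPath.insert_iff he hv]

theorem dowlingUnbalanced_insert_of_notMem [Finite G] (he : p.Edge y i g j)
    (hv : v ∉ dowlingComponent y (insert p X) i) :
    DowlingUnbalanced y (insert p X) v ↔ DowlingUnbalanced y X v := by
  simp only [DowlingUnbalanced, DowlingPath.insert_iff he hv]

theorem dowlingComponentEdges_insert_of_notMem [Finite G] (he : p.Edge y i g j)
    (hv : v ∉ dowlingComponent y (insert p X) i) :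
    dowlingComponentEdges y (insert p X) v = dowlingComponentEdges y X v := by
  ext a
  simp only [dowlingComponentEdges, dowlingComponent_insert_of_notMem he hv, Set.mem_ofPred_eq]
  refine ⟨?_, fun ⟨ha, h⟩ => ⟨Or.inr ha, h⟩⟩
  rintro ⟨rfl | ha, w, hw, b, l, hwl⟩
  · exfalso
    apply hv
    rw [dowlingComponent_insert he]
    obtain ⟨c, hc⟩ := hw
    rcases he.unique hwl with ⟨rfl, -⟩ | ⟨-, rfl, -⟩
    · exact Or.inl ⟨_, hc.symm⟩
    · exact Or.inr ⟨_, hc.symm⟩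
  · exact ⟨ha, w, hw, b, l, hwl⟩

/-- Joining two different components, both balanced, yields a balanced component. -/
theorem dowlingUnbalanced_insert_of_disjoint [Finite G] (he : p.Edge y i g j)
    (hj : j ∉ dowlingComponent y X i) :
    DowlingUnbalanced y (insert p X) i ↔ DowlingUnbalanced y X i ∨ DowlingUnbalanced y X j := by
  constructor
  · by_contra! hcon
    obtain ⟨⟨a, ha, hp⟩, hi', hj'⟩ := hcon
    have hi1 : ∀ {b}, DowlingPath y X i b i → b = 1 := fun {b} hb => by
      by_contra h; exact hi' ⟨b, h, hb⟩
    have hj1 : ∀ {b}, DowlingPath y X j b j → b = 1 := fun {b} hb => by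
      by_contra h; exact hj' ⟨b, h, hb⟩
    have hij : ∀ {b}, ¬ DowlingPath y X i b j := fun hb => hj ⟨_, hb⟩
    have hji : ∀ {b}, ¬ DowlingPath y X j b i := fun hb => hj ⟨_, hb.symm⟩
    -- Up to cancellation a path crosses `p` at most once: between a crossing and the return lies a
    -- closed path in a balanced component, whose label is 1.
    have key : ∀ {v w : Fin n} {h : G}, DowlingPath y (insert p X) v h w →
        DowlingPath y X v h w ∨
        (∃ a b, DowlingPath y X v a i ∧ DowlingPath y X j b w ∧ h = a * g * b) ∨
        (∃ a b, DowlingPath y X v a j ∧ DowlingPath y X i b w ∧ h = a * g⁻¹ * b) := by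
      intro v w h hp
      induction hp with
      | nil v => exact Or.inl (.nil v)
      | cons ha he' _ ih =>
        rcases ha with rfl | ha
        · rcases he.unique he' with ⟨rfl, rfl, rfl⟩ | ⟨-, rfl, rfl, rfl⟩
          · rcases ih with ih | ⟨a, b, ih, -, -⟩ | ⟨a, b, iha, ihb, rfl⟩
            · exact Or.inr (Or.inl ⟨1, _, .nil _, ih, by group⟩)
            · exact absurd ih hji
            · obtain rfl := hj1 iha
              left
              simpa using ihb
          · rcases ih with ih | ⟨a, b, iha, ihb, rfl⟩ | ⟨a, b, ih, -, -⟩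
            · exact Or.inr (Or.inr ⟨1, _, .nil _, ih, by group⟩)
            · obtain rfl := hi1 iha
              left
              simpa using ihb
            · exact absurd ih hij
        · rcases ih with ih | ⟨a, b, iha, ihb, rfl⟩ | ⟨a, b, iha, ihb, rfl⟩
          · exact Or.inl (.cons ha he' ih)
          · exact Or.inr (Or.inl ⟨_, b, .cons ha he' iha, ihb, by group⟩)
          · exact Or.inr (Or.inr ⟨_, b, .cons ha he' iha, ihb, by group⟩)
    rcases key hp with h | ⟨a, b, -, h, -⟩ | ⟨a, b, h, -, -⟩
    · exact ha (hi1 h)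
    · exact hji h
    · exact hij h
  · rintro (h | h)
    · exact h.mono (Set.subset_insert _ _)
    · exact (h.mono (Set.subset_insert p X)).of_path (.of_edge (Set.mem_insert _ _) he)

/-- If `X` already has a path with the label of `p`, that path can replace `p`; otherwise `p`
followed by any path back is a nontrivial closed path. -/
theorem dowlingUnbalanced_insert_of_mem [Finite G] (he : p.Edge y i g j)
    (hj : j ∈ dowlingComponent y X i) :
    DowlingUnbalanced y (insert p X) i ↔ DowlingUnbalanced y X i ∨ ¬ DowlingPath y X i g j := by
  constructor
  · rintro ⟨a, ha, hp⟩
    by_contra! hcon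
    obtain ⟨hi, hg⟩ := hcon
    have key : ∀ {v w : Fin n} {h : G}, DowlingPath y (insert p X) v h w →
        DowlingPath y X v h w := by
      intro v w h hp
      induction hp with
      | nil v => exact .nil v
      | cons ha he' _ ih =>
        rcases ha with rfl | ha
        · rcases he.unique he' with ⟨rfl, rfl, rfl⟩ | ⟨-, rfl, rfl, rfl⟩
          · exact hg.trans ih
          · exact hg.symm.trans ih
        · exact .cons ha he' ih
    exact hi ⟨a, ha, key hp⟩
  · rintro (h | h)
    · exact h.mono (Set.subset_insert _ _)
    · obtain ⟨c, hc⟩ := hj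
      refine ⟨g * c⁻¹, fun h1 => h ?_, .cons (Set.mem_insert _ _) he
        (hc.symm.mono (Set.subset_insert _ _))⟩
      rwa [mul_inv_eq_one.1 h1]

theorem disjoint_dowlingComponent [Finite G] (hj : j ∉ dowlingComponent y X i) :
    Disjoint (dowlingComponent y X i) (dowlingComponent y X j) := by
  rw [Set.disjoint_left]
  rintro v ⟨a, ha⟩ ⟨b, hb⟩
  exact hj ⟨_, ha.trans hb.symm⟩

theorem disjoint_dowlingComponentEdges [Finite G] (hj : j ∉ dowlingComponent y X i) :
    Disjoint (dowlingComponentEdges y X i) (dowlingComponentEdges y X j) := by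
  rw [Set.disjoint_left]
  rintro a ⟨ha, v, ⟨b, hv⟩, c, l, hvl⟩ ⟨-, w, ⟨b', hw⟩, c', l', hwl⟩
  rcases hvl.unique hwl with ⟨rfl, -⟩ | ⟨-, rfl, -⟩
  · exact hj ⟨_, hv.trans hw.symm⟩
  · exact hj ⟨_, (hv.trans (.of_edge ha hvl)).trans hw.symm⟩

end Insert

/-! ### Weights and the insertion criterion -/

section Independence

variable {n : ℕ} {G : Type*} [Group G] {y : G} {X Y : Set (DowlingPoint n G)}
  {p : DowlingPoint n G} {i j v w : Fin n} {g h : G}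

open Classical in
/-- The number of edges of a component, increased by one if the component is balanced. -/
noncomputable def dowlingWeight {n : ℕ} {G : Type*} [Group G] (y : G) (X : Set (DowlingPoint n G))
    (v : Fin n) : ℕ :=
  (dowlingComponentEdges y X v).ncard + if DowlingUnbalanced y X v then 0 else 1

theorem notMem_dowlingComponentEdges (hp : p ∉ X) : p ∉ dowlingComponentEdges y X v :=
  fun h => hp h.1

theorem dowlingComponent_empty : dowlingComponent y (∅ : Set (DowlingPoint n G)) v = {v} := by
  ext w
  refine ⟨fun ⟨a, ha⟩ => (ha.eq_of_isolated (by simp)).1, ?_⟩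
  rintro rfl
  exact mem_dowlingComponent_self

theorem dowlingWeight_empty : dowlingWeight y (∅ : Set (DowlingPoint n G)) v = 1 := by
  have h1 : ¬ DowlingUnbalanced y (∅ : Set (DowlingPoint n G)) v := by
    rintro ⟨a, ha, hp⟩
    exact ha (hp.eq_of_isolated (by simp)).2
  simp [dowlingWeight, h1, dowlingComponentEdges]

variable [Finite G]

theorem dowlingWeight_eq (hv : v ∈ dowlingComponent y X i) :
    dowlingWeight y X v = dowlingWeight y X i := by
  rw [dowlingWeight, dowlingWeight, dowlingComponentEdges_eq hv, propext (dowlingUnbalanced_iff hv)]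

theorem dowlingWeight_insert_of_notMem (he : p.Edge y i g j)
    (hv : v ∉ dowlingComponent y (insert p X) i) :
    dowlingWeight y (insert p X) v = dowlingWeight y X v := by
  rw [dowlingWeight, dowlingWeight, dowlingComponentEdges_insert_of_notMem he hv,
    propext (dowlingUnbalanced_insert_of_notMem he hv)]

open Classical in
-- Merging adds an edge. If at least one side is balanced, exactly one balance bonus is lost and
-- offsets it; if both are unbalanced, nothing offsets it, and this is when `p` is in the closure.
theorem dowlingWeight_insert_of_disjoint (he : p.Edge y i g j) (hp : p ∉ X)
    (hj : j ∉ dowlingComponent y X i) :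
    dowlingWeight y (insert p X) i =
      dowlingWeight y X i + dowlingWeight y X j + if p ∈ dowlingClosure y X then 1 else 0 := by
  have hcl : p ∈ dowlingClosure y X ↔ DowlingUnbalanced y X i ∧ DowlingUnbalanced y X j := by
    rw [mem_dowlingClosure_iff he]
    exact ⟨fun h => h.resolve_left fun h => hj ⟨_, h⟩, Or.inr⟩
  have hE : (dowlingComponentEdges y (insert p X) i).ncard =
      (dowlingComponentEdges y X i).ncard + (dowlingComponentEdges y X j).ncard + 1 := by
    rw [dowlingComponentEdges_insert he, Set.ncard_insert_of_notMem (fun h => h.elim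
      (notMem_dowlingComponentEdges hp) (notMem_dowlingComponentEdges hp)),
      Set.ncard_union_eq (disjoint_dowlingComponentEdges hj)]
  simp only [dowlingWeight, hE, hcl, dowlingUnbalanced_insert_of_disjoint he hj]
  by_cases h1 : DowlingUnbalanced y X i <;> by_cases h2 : DowlingUnbalanced y X j <;>
    simp [h1, h2] <;> omega

open Classical in
theorem dowlingWeight_insert_of_mem (he : p.Edge y i g j) (hp : p ∉ X)
    (hj : j ∈ dowlingComponent y X i) :
    dowlingWeight y (insert p X) i =
      dowlingWeight y X i + if p ∈ dowlingClosure y X then 1 else 0 := by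
  have hcl : p ∈ dowlingClosure y X ↔ DowlingPath y X i g j ∨ DowlingUnbalanced y X i := by
    rw [mem_dowlingClosure_iff he, DowlingSpans, dowlingUnbalanced_iff hj, and_self_iff]
  have hE : (dowlingComponentEdges y (insert p X) i).ncard =
      (dowlingComponentEdges y X i).ncard + 1 := by
    rw [dowlingComponentEdges_insert he, dowlingComponentEdges_eq hj, Set.union_self,
      Set.ncard_insert_of_notMem (notMem_dowlingComponentEdges hp)]
  simp only [dowlingWeight, hE, hcl, dowlingUnbalanced_insert_of_mem he hj]
  by_cases h1 : DowlingUnbalanced y X i <;> by_cases h2 : DowlingPath y X i g j <;>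
    simp [h1, h2]

theorem ncard_dowlingComponent_insert_of_disjoint (he : p.Edge y i g j)
    (hj : j ∉ dowlingComponent y X i) :
    (dowlingComponent y (insert p X) i).ncard =
      (dowlingComponent y X i).ncard + (dowlingComponent y X j).ncard := by
  rw [dowlingComponent_insert he, Set.ncard_union_eq (disjoint_dowlingComponent hj)]

theorem ncard_dowlingComponent_insert_of_mem (he : p.Edge y i g j)
    (hj : j ∈ dowlingComponent y X i) :
    (dowlingComponent y (insert p X) i).ncard = (dowlingComponent y X i).ncard := by
  rw [dowlingComponent_insert he, dowlingComponent_eq hj, Set.union_self]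

/-- Inserting a point combines vertex counts and weights alike, except that the weight gains an
extra 1 when the point is in the closure. -/
theorem ncard_dowlingComponent_le (X : Set (DowlingPoint n G)) (v : Fin n) :
    (dowlingComponent y X v).ncard ≤ dowlingWeight y X v := by
  induction X, X.toFinite using Set.Finite.induction_on generalizing v with
  | empty => simp [dowlingComponent_empty, dowlingWeight_empty]
  | @insert p X hp _ ih =>
    obtain ⟨i, g, j, he⟩ := p.exists_edge y
    by_cases hv : v ∈ dowlingComponent y (insert p X) i
    · rw [dowlingComponent_eq hv, dowlingWeight_eq hv]
      have hi := ih i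
      have hj := ih j
      by_cases hji : j ∈ dowlingComponent y X i
      · rw [ncard_dowlingComponent_insert_of_mem he hji, dowlingWeight_insert_of_mem he hp hji]
        omega
      · rw [ncard_dowlingComponent_insert_of_disjoint he hji,
          dowlingWeight_insert_of_disjoint he hp hji]
        omega
    · rw [dowlingComponent_insert_of_notMem he hv, dowlingWeight_insert_of_notMem he hv]
      exact ih v

/-- The bound on vertices rules out the tree count for an unbalanced component, so each alternative
of the definition is equality in one of the two cases of the weight. -/
theorem mem_dowlingIndep_iff :
    X ∈ dowlingIndep y ↔ ∀ v, (dowlingComponent y X v).ncard = dowlingWeight y X v := by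
  refine forall_congr' fun v => ?_
  have hle := ncard_dowlingComponent_le (y := y) X v
  have hu : (∃ j ∈ dowlingComponent y X v, ∃ g, g ≠ 1 ∧ DowlingPath y X j g j) ↔
      DowlingUnbalanced y X v :=
    ⟨fun ⟨j, hj, h⟩ => (dowlingUnbalanced_iff hj).1 h, fun h => ⟨v, mem_dowlingComponent_self, h⟩⟩
  rw [hu]
  unfold dowlingWeight at hle ⊢
  by_cases h : DowlingUnbalanced y X v
  · simp only [h, if_true, and_true] at hle ⊢
    omega
  · simp only [h, if_false, and_false, or_false]

theorem empty_mem_dowlingIndep : (∅ : Set (DowlingPoint n G)) ∈ dowlingIndep y := by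
  simp [mem_dowlingIndep_iff, dowlingComponent_empty, dowlingWeight_empty]

/-- A point outside an independent set can be added exactly if it is not in the closure. -/
theorem insert_mem_dowlingIndep_iff (hp : p ∉ X) :
    insert p X ∈ dowlingIndep y ↔ X ∈ dowlingIndep y ∧ p ∉ dowlingClosure y X := by
  obtain ⟨i, g, j, he⟩ := p.exists_edge y
  simp only [mem_dowlingIndep_iff]
  have hi := ncard_dowlingComponent_le (y := y) X i
  have hj := ncard_dowlingComponent_le (y := y) X j
  -- Both sides add up from the parts, where `≤` holds, so equality forces equality in each part and
  -- no extra 1.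
  have hI : (dowlingComponent y (insert p X) i).ncard = dowlingWeight y (insert p X) i ↔
      (dowlingComponent y X i).ncard = dowlingWeight y X i ∧
      (dowlingComponent y X j).ncard = dowlingWeight y X j ∧ p ∉ dowlingClosure y X := by
    by_cases hji : j ∈ dowlingComponent y X i
    · rw [ncard_dowlingComponent_insert_of_mem he hji, dowlingWeight_insert_of_mem he hp hji,
        dowlingComponent_eq hji, dowlingWeight_eq hji]
      split_ifs with h <;> simp only [h, not_true, not_false_iff, and_true, and_false, iff_false] <;>
        omega
    · rw [ncard_dowlingComponent_insert_of_disjoint he hji,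
        dowlingWeight_insert_of_disjoint he hp hji]
      split_ifs with h <;> simp only [h, not_true, not_false_iff, and_true, and_false, iff_false] <;>
        omega
  constructor
  · intro hall
    obtain ⟨h1, h2, h3⟩ := hI.1 (hall i)
    refine ⟨fun v => ?_, h3⟩
    by_cases hv : v ∈ dowlingComponent y (insert p X) i
    · rw [dowlingComponent_insert he] at hv
      rcases hv with hv | hv <;> rwa [dowlingComponent_eq hv, dowlingWeight_eq hv]
    · rw [← dowlingComponent_insert_of_notMem he hv, ← dowlingWeight_insert_of_notMem he hv]
      exact hall v
  · rintro ⟨hall, h3⟩ v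
    by_cases hv : v ∈ dowlingComponent y (insert p X) i
    · rw [dowlingComponent_eq hv, dowlingWeight_eq hv]
      exact hI.2 ⟨hall i, hall j, h3⟩
    · rw [dowlingComponent_insert_of_notMem he hv, dowlingWeight_insert_of_notMem he hv]
      exact hall v

end Independence

/-! ### Line-closed sets, flats and transversals -/

section Flats

variable {n : ℕ} {G : Type*} [Group G] [Finite G] {y : G} {T X Y : Set (DowlingPoint n G)}
  {p a b : DowlingPoint n G} {i j l : Fin n} {g h : G}

theorem singleton_mem_dowlingIndep (hy : y ≠ 1) (a : DowlingPoint n G) :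
    {a} ∈ dowlingIndep y := by
  rw [← insert_empty_eq, insert_mem_dowlingIndep_iff (Set.notMem_empty a)]
  refine ⟨empty_mem_dowlingIndep, ?_⟩
  rintro ⟨i, g, j, he, h | ⟨⟨b, hb, h⟩, -⟩⟩
  · obtain ⟨rfl, rfl⟩ := h.eq_of_isolated (by simp)
    exact hy he.eq_of_loop.symm
  · exact hb (h.eq_of_isolated (by simp)).2

/-- A set is closed under lines if it contains the closure of any two of its points. -/
def IsLineClosed {n : ℕ} {G : Type*} [Group G] (y : G) (T : Set (DowlingPoint n G)) : Prop :=
  ∀ a ∈ T, ∀ b ∈ T, dowlingClosure y {a, b} ⊆ T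

/-- Along paths in a line-closed set, endpoints are joined by an edge or carry loops. -/
theorem IsLineClosed.path (hT : IsLineClosed y T) (hp : DowlingPath y T i g j) :
    (i = j ∧ g = 1) ∨ (∃ a ∈ T, a.Edge y i g j) ∨
      ((∃ a ∈ T, a.Edge y i y i) ∧ ∃ a ∈ T, a.Edge y j y j) := by
  induction hp with
  | nil i => exact Or.inl ⟨rfl, rfl⟩
  | @cons i j l g h a ha he _ ih =>
    rcases ih with ⟨rfl, rfl⟩ | ⟨b, hb, hbe⟩ | ⟨⟨b, hb, hbe⟩, hl⟩
    · right; left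
      exact ⟨a, ha, by rwa [mul_one]⟩
    -- Two consecutive edges contract inside the line of `a` and `b`: to nothing, to one edge, or,
    -- for a nontrivial closed path, to a loop.
    · have hpath : DowlingPath y {a, b} i (g * h) l :=
        .cons (by simp) he (.of_edge (by simp) hbe)
      by_cases hil : i = l
      · subst hil
        by_cases hgh : g * h = 1
        · exact Or.inl ⟨rfl, hgh⟩
        · obtain ⟨c, hc⟩ := DowlingPoint.exists_loop y i
          have : c ∈ T := hT a ha b hb
            ⟨i, y, i, hc, Or.inr ⟨⟨_, hgh, hpath⟩, ⟨_, hgh, hpath⟩⟩⟩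
          exact Or.inr (Or.inr ⟨⟨c, this, hc⟩, c, this, hc⟩)
      · obtain ⟨c, hc⟩ := DowlingPoint.exists_edge_of_ne y hil (g * h)
        exact Or.inr (Or.inl ⟨c, hT a ha b hb ⟨i, _, l, hc, Or.inl hpath⟩, hc⟩)
    · refine Or.inr (Or.inr ⟨?_, hl⟩)
      obtain ⟨c, hc⟩ := DowlingPoint.exists_loop y i
      refine ⟨c, ?_, hc⟩
      by_cases hy : y = 1
      · subst hy
        exact hT a ha b hb ⟨i, _, i, hc, Or.inl (.nil i)⟩
      -- The loop `b` at the middle vertex is transported back along `a`.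
      · have hu : DowlingUnbalanced y {a, b} i :=
          DowlingUnbalanced.of_path ⟨y, hy, .of_edge (a := b) (by simp) hbe⟩
            (.of_edge (a := a) (by simp) he)
        exact hT a ha b hb ⟨i, _, i, hc, Or.inr ⟨hu, hu⟩⟩

/-- In a Dowling matroid, sets closed under lines are flats. -/
theorem IsLineClosed.dowlingClosure_subset (hy : y ≠ 1) (hT : IsLineClosed y T) (hX : X ⊆ T) :
    dowlingClosure y X ⊆ T := by
  rintro p ⟨i, g, j, he, hs⟩
  have hloops : (∃ a ∈ T, a.Edge y i y i) → (∃ a ∈ T, a.Edge y j y j) → p ∈ T := by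
    rintro ⟨a, ha, hae⟩ ⟨b, hb, hbe⟩
    exact hT a ha b hb ⟨i, g, j, he, Or.inr ⟨⟨y, hy, .of_edge (by simp) hae⟩,
      ⟨y, hy, .of_edge (a := b) (by simp) hbe⟩⟩⟩
  have hunb : ∀ {i}, DowlingUnbalanced y X i → ∃ a ∈ T, a.Edge y i y i := by
    rintro i ⟨c, hc, hp⟩
    rcases hT.path (hp.mono hX) with ⟨-, h⟩ | ⟨a, ha, hae⟩ | ⟨h, -⟩
    · exact absurd h hc
    · obtain rfl := hae.eq_of_loop
      exact ⟨a, ha, hae⟩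
    · exact h
  rcases hs with hp | ⟨hi, hj⟩
  · rcases hT.path (hp.mono hX) with ⟨rfl, rfl⟩ | ⟨a, ha, hae⟩ | ⟨hi, hj⟩
    · exact absurd he.eq_of_loop.symm hy
    · exact hT a ha a ha ⟨i, g, j, he, Or.inl (.of_edge (by simp) hae)⟩
    · exact hloops hi hj
  · exact hloops (hunb hi) (hunb hj)

/-- A set is line-closed if independent sets of at most two of its points can be extended by
every other point. -/
theorem isLineClosed_of_insert_mem (hy : y ≠ 1)
    (hT : ∀ X ∈ dowlingIndep y, X.ncard ≤ 2 → X ⊆ T → ∀ p, p ∉ T → insert p X ∈ dowlingIndep y) :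
    IsLineClosed y T := by
  have key : ∀ X ∈ dowlingIndep y, X.ncard ≤ 2 → X ⊆ T → dowlingClosure y X ⊆ T := by
    intro X hX hc hXT p hp
    by_contra hpT
    exact ((insert_mem_dowlingIndep_iff fun h => hpT (hXT h)).1 (hT X hX hc hXT p hpT)).2 hp
  intro a ha b hb
  -- Only independent sets may be tested; if the pair is not known to be independent, `{b}` has the
  -- same closure.
  by_cases hab : a ∈ dowlingClosure y {b}
  · have : dowlingClosure y {a, b} ⊆ dowlingClosure y {b} := by
      refine (dowlingClosure_mono ?_).trans dowlingClosure_dowlingClosure_subset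
      exact Set.insert_subset hab subset_dowlingClosure
    exact this.trans (key {b} (singleton_mem_dowlingIndep hy b) (by simp) (by simpa using hb))
  · refine key {a, b} ?_ ((Set.ncard_insert_le a {b}).trans (by simp))
      (Set.insert_subset ha (by simpa using hb))
    have hne : a ∉ ({b} : Set (DowlingPoint n G)) := fun h => hab (subset_dowlingClosure h)
    exact (insert_mem_dowlingIndep_iff hne).2 ⟨singleton_mem_dowlingIndep hy b, hab⟩

theorem insert_mem_dowlingIndep_of_notMem_closure (hX : X ∈ dowlingIndep y)
    (hXY : X ⊆ dowlingClosure y Y) (hp : p ∉ dowlingClosure y Y) :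
    insert p X ∈ dowlingIndep y :=
  (insert_mem_dowlingIndep_iff fun h => hp (hXY h)).2
    ⟨hX, fun h => hp (dowlingClosure_dowlingClosure_subset (dowlingClosure_mono hXY h))⟩

/-- Independent sets are the transversals of any family of line-closed sets which contains
all flats. -/
theorem dowlingIndep_eq_transversals (hy : y ≠ 1) {R : Set (Set (DowlingPoint n G))}
    (hcl : ∀ X, dowlingClosure y X ∈ R) (hR : ∀ T ∈ R, IsLineClosed y T) :
    dowlingIndep y = transversals R := by
  ext X
  constructor
  · intro hX
    -- Recording that the chain ends at the closure of `X` lets the induction append the next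
    -- closure.
    suffices h : ∃ (m : ℕ) (T : Fin (m + 1) → Set (DowlingPoint n G))
        (x : Fin m → DowlingPoint n G), StrictMono T ∧ (∀ i, T i ∈ R) ∧
        (∀ i : Fin m, x i ∈ T i.succ \ T i.castSucc) ∧ X = Set.range x ∧
        T (Fin.last m) = dowlingClosure y X by
      obtain ⟨m, T, x, h1, h2, h3, h4, -⟩ := h
      exact ⟨m, T, x, h1, h2, h3, h4⟩
    induction X, X.toFinite using Set.Finite.induction_on with
    | empty =>
      exact ⟨0, fun _ => dowlingClosure y ∅, Fin.elim0, Subsingleton.strictMono (α := Fin 1) _,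
        fun _ => hcl ∅, fun i => i.elim0, by simp, rfl⟩
    | @insert p X hp _ ih =>
      obtain ⟨hX, hpX⟩ := (insert_mem_dowlingIndep_iff hp).1 hX
      obtain ⟨m, T, x, h1, h2, h3, h4, h5⟩ := ih hX
      have hlt : dowlingClosure y X ⊂ dowlingClosure y (insert p X) :=
        ⟨dowlingClosure_mono (Set.subset_insert _ _), fun h =>
          hpX (h (subset_dowlingClosure (Set.mem_insert _ _)))⟩
      refine ⟨m + 1, Fin.snoc (α := fun _ => Set (DowlingPoint n G)) T
        (dowlingClosure y (insert p X)),
        Fin.snoc (α := fun _ => DowlingPoint n G) x p, ?_, ?_, ?_, ?_, ?_⟩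
      · rw [Fin.strictMono_iff_lt_succ]
        intro i
        induction i using Fin.lastCases with
        | last =>
          rw [Fin.snoc_castSucc, Fin.succ_last, Fin.snoc_last, h5]
          exact hlt
        | cast i =>
          rw [Fin.snoc_castSucc, Fin.succ_castSucc, Fin.snoc_castSucc]
          exact h1 i.castSucc_lt_succ
      · intro i
        induction i using Fin.lastCases with
        | last => rw [Fin.snoc_last]; exact hcl _
        | cast i => rw [Fin.snoc_castSucc]; exact h2 i
      · intro i
        induction i using Fin.lastCases with
        | last =>
          rw [Fin.snoc_castSucc, Fin.succ_last, Fin.snoc_last, Fin.snoc_last, h5]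
          exact ⟨subset_dowlingClosure (Set.mem_insert _ _), hpX⟩
        | cast i =>
          rw [Fin.snoc_castSucc, Fin.succ_castSucc, Fin.snoc_castSucc, Fin.snoc_castSucc]
          exact h3 i
      · rw [Fin.range_snoc, h4]
      · rw [Fin.snoc_last]
  · rintro ⟨m, T, x, h1, h2, h3, rfl⟩
    -- The first points lie in the flat `T l`, which therefore contains their closure but not the
    -- next point.
    suffices h : ∀ l : Fin (m + 1), x '' {i | i.castSucc < l} ∈ dowlingIndep y ∧
        x '' {i | i.castSucc < l} ⊆ T l by
      have := (h (Fin.last m)).1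
      simpa [Fin.castSucc_lt_last] using this
    intro l
    induction l using Fin.induction with
    | zero => simp [empty_mem_dowlingIndep]
    | succ l ih =>
      have hset : x '' {i | i.castSucc < l.succ} =
          insert (x l) (x '' {i | i.castSucc < l.castSucc}) := by
        rw [← Set.image_insert_eq]
        congr 1
        ext i
        simp only [Set.mem_ofPred_eq, Set.mem_insert_iff, Fin.lt_def, Fin.ext_iff, Fin.val_castSucc,
          Fin.val_succ]
        omega
      rw [hset]
      refine ⟨?_, Set.insert_subset (h3 l).1 (ih.2.trans (h1 l.castSucc_lt_succ).le)⟩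
      rw [insert_mem_dowlingIndep_iff fun h => (h3 l).2 (ih.2 h)]
      exact ⟨ih.1, fun h => (h3 l).2 ((hR _ (h2 _)).dowlingClosure_subset hy ih.2 h)⟩

/-- Adding a loop at an isolated vertex preserves independence. -/
theorem insert_loop_mem_dowlingIndep (hy : y ≠ 1) (hX : X ∈ dowlingIndep y)
    (hp : p.Edge y i y i) (hi : ∀ a ∈ X, ∀ g j, ¬ a.Edge y i g j) :
    insert p X ∈ dowlingIndep y := by
  rw [insert_mem_dowlingIndep_iff fun h => hi p h _ _ hp]
  refine ⟨hX, ?_⟩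
  rw [mem_dowlingClosure_iff hp]
  rintro (h | ⟨⟨g, hg, h⟩, -⟩)
  · exact hy (h.eq_of_isolated hi).2
  · exact hg (h.eq_of_isolated hi).2

theorem exists_mem_dowlingIndep_ncard_eq_three (hy : y ≠ 1) (hn : 3 ≤ n) :
    ∃ X : Set (DowlingPoint n G), X ∈ dowlingIndep y ∧ X.ncard = 3 := by
  -- Loops at the first `m` vertices; the last clause keeps vertex `m` isolated for the next loop.
  have key : ∀ m ≤ n, ∃ X : Set (DowlingPoint n G), X ∈ dowlingIndep y ∧ X.ncard = m ∧
      ∀ a ∈ X, ∀ i g j, a.Edge y i g j → (i : ℕ) < m := by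
    intro m
    induction m with
    | zero => exact fun _ => ⟨∅, empty_mem_dowlingIndep, by simp, by simp⟩
    | succ m ih =>
      intro hm
      obtain ⟨X, hX, hc, hlt⟩ := ih (by omega)
      obtain ⟨p, hp⟩ := DowlingPoint.exists_loop y (⟨m, hm⟩ : Fin n)
      have hiso : ∀ a ∈ X, ∀ g j, ¬ a.Edge y ⟨m, hm⟩ g j :=
        fun a ha g j h => lt_irrefl _ (hlt a ha _ g j h)
      refine ⟨insert p X, insert_loop_mem_dowlingIndep hy hX hp hiso, ?_, ?_⟩
      · rw [Set.ncard_insert_of_notMem fun h => hiso p h _ _ hp, hc]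
      · rintro a (rfl | ha) i g j h
        · rcases hp.unique h with ⟨rfl, -⟩ | ⟨h, -⟩
          · simp
          · exact absurd rfl h
        · exact (hlt a ha i g j h).trans m.lt_succ_self
  obtain ⟨X, hX, hc, -⟩ := key 3 hn
  exact ⟨X, hX, hc⟩

end Flats

/-! ### Dimension of truncations and conclusion -/

theorem complexDim_truncation_lt {V : Type*} (H : Set (Set V)) {k : ℕ} (hk : 0 < k) :
    complexDim (truncation H k) < k := by
  have : sSup {m | ∃ X ∈ truncation H k, X.ncard = m} ≤ k := by
    rcases Set.eq_empty_or_nonempty {m | ∃ X ∈ truncation H k, X.ncard = m} with h | h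
    · simp [h]
    · refine csSup_le h ?_
      rintro m ⟨X, hX, rfl⟩
      exact hX.2
  unfold complexDim
  omega

theorem le_complexDim_truncation {V : Type*} {H : Set (Set V)} {k : ℕ} {X : Set V} (hX : X ∈ H)
    (hXk : X.ncard ≤ k) : X.ncard - 1 ≤ complexDim (truncation H k) := by
  have hb : BddAbove {m | ∃ Y ∈ truncation H k, Y.ncard = m} := by
    refine ⟨k, ?_⟩
    rintro m ⟨Y, hY, rfl⟩
    exact hY.2
  exact Nat.sub_le_sub_right (le_csSup hb ⟨X, ⟨hX, hXk⟩, rfl⟩) 1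

theorem mainTheorem11 {G : Type*} [Group G] [Finite G] [Nontrivial G] (y : G) (hy : y ≠ 1)
    (n : ℕ) (hn : 2 ≤ n) (k : ℕ) (hk : 3 ≤ k) :
    (dowlingIndep y : Set (Set (DowlingPoint n G))) = transversals (truncT (dowlingIndep y) k) ∧
    (3 ≤ n → (dowlingIndep y : Set (Set (DowlingPoint n G))) =
      transversals (familyT (truncation (dowlingIndep y) k))) := by
  refine ⟨dowlingIndep_eq_transversals hy ?_ ?_, fun hn3 => dowlingIndep_eq_transversals hy ?_ ?_⟩
  · rintro Y X ⟨hX, hXk⟩ hXY p hp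
    refine ⟨insert_mem_dowlingIndep_of_notMem_closure hX hXY hp, ?_⟩
    have := Set.ncard_insert_le p X
    omega
  · intro T hT
    exact isLineClosed_of_insert_mem hy fun X hX hc hXT p hp =>
      (hT X ⟨hX, by omega⟩ hXT p hp).1
  · rintro Y X ⟨⟨hX, -⟩, hXk⟩ hXY p hp
    refine ⟨insert_mem_dowlingIndep_of_notMem_closure hX hXY hp, ?_⟩
    have := Set.ncard_insert_le p X
    have := complexDim_truncation_lt (dowlingIndep y : Set (Set (DowlingPoint n G)))
      (k := k) (by omega)
    omega
  · intro T hT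
    obtain ⟨Z, hZ, hZ3⟩ := exists_mem_dowlingIndep_ncard_eq_three (G := G) hy hn3
    -- Three independent points give dimension at least 2, so pairs are among the tested sets.
    have := le_complexDim_truncation hZ (hZ3.trans_le hk)
    exact isLineClosed_of_insert_mem hy fun X hX hc hXT p hp =>
      (hT X ⟨⟨hX, by omega⟩, by omega⟩ hXT p hp).1
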